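/- Let $\{p_n\}_{n=1}^\infty$ and $\{q_n\}_{n=1}^\infty$ be sequences of real numbers with $1 \le q_n \le p_n < \infty$ for all $n \in \mathbb{N}$, and suppose that either $1 < \inf_n p_n \le \sup_n p_n < \infty$ or $\sup_n q_n < \infty$. For a sequence $\{s_n\}$ in $[1,\infty)$ let $\ell_{\{s_n\}}$ be the Nakano sequence space of all real sequences $x = \{x_n\}$ with $\sum_n (|x_n|/\varrho)^{s_n} < \infty$ for some $\varrho > 0$, normed by $\|x\| = \inf\{\varrho > 0 : \sum_n (|x_n|/\varrho)^{s_n} \le 1\}$. Let $\lambda = \{\lambda_n\}$ be a real sequence which is a pointwise multiplier from $\ell_{\{p_n\}}$ to $\ell_{\{q_n\}}$, that is, $\{\lambda_n x_n\} \in \ell_{\{q_n\}}$ for every $x \in \ell_{\{p_n\}}$, and for $n$ with $q_n < p_n$ define $r_n$ by $1/r_n = 1/q_n - 1/p_n$. Then the multiplication operator $M_\lambda \colon \ell_{\{p_n\}} \to \ell_{\{q_n\}}$, $x \mapsto \{\lambda_n x_n\}$, is compact if, and only if, $$\forall \ell > 1 \colon \quad \lim_{k \to \infty} \sum_{\{ n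 \,:\, \lambda_n \ne 0,\ q_n < p_n,\ r_n > \frac{\log k}{\log \ell} \}} (|\lambda_n|\, \ell)^{r_n} = 0$$ (where the sums take values in $[0,\infty]$), and moreover $\lambda_n \to 0$ along the indices $n$ with $p_n = q_n$ (a condition which is void if there are only finitely many such $n$). -/

import Mathlib

open Filter Topology
open scoped ENNReal

noncomputable section

/-- The modular `∑ₙ |xₙ| ^ pₙ ∈ [0, ∞]` of a real sequence. -/
def nakanoModular (p x : ℕ → ℝ) : ℝ≥0∞ :=
  ∑' n, ENNReal.ofReal (|x n| ^ p n)

/-- `x ∈ ℓ_{pₙ}`: the modular of `x / ρ` is finite for some `ρ > 0`. -/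
def MemNakano (p x : ℕ → ℝ) : Prop :=
  ∃ ρ : ℝ, 0 < ρ ∧ nakanoModular p (ρ⁻¹ • x) < ∞

/-- The Luxemburg--Nakano norm `inf {ρ > 0 : ∑ₙ (|xₙ| / ρ) ^ pₙ ≤ 1}`. -/
def nakanoNorm (p x : ℕ → ℝ) : ℝ :=
  sInf {ρ : ℝ | 0 < ρ ∧ nakanoModular p (ρ⁻¹ • x) ≤ 1}

theorem nakanoModular_smul_le {p : ℕ → ℝ} (hp : ∀ n, 1 ≤ p n) (x : ℕ → ℝ) {c : ℝ}
    (hc : |c| ≤ 1) : nakanoModular p (c • x) ≤ ENNReal.ofReal |c| * nakanoModular p x := by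
  unfold nakanoModular
  rw [← ENNReal.tsum_mul_left]
  refine ENNReal.tsum_le_tsum fun n => ?_
  rw [← ENNReal.ofReal_mul (abs_nonneg c)]
  apply ENNReal.ofReal_le_ofReal
  rw [Pi.smul_apply, smul_eq_mul, abs_mul, Real.mul_rpow (abs_nonneg _) (abs_nonneg _)]
  refine mul_le_mul_of_nonneg_right ?_ (Real.rpow_nonneg (abs_nonneg _) _)
  simpa using Real.rpow_le_rpow_of_exponent_ge' (abs_nonneg c) hc zero_le_one (hp n)

theorem nakanoModular_convex {p : ℕ → ℝ} (hp : ∀ n, 1 ≤ p n) (x y : ℕ → ℝ) {a b : ℝ}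
    (ha : 0 ≤ a) (hb : 0 ≤ b) (hab : a + b = 1) :
    nakanoModular p (a • x + b • y) ≤
      ENNReal.ofReal a * nakanoModular p x + ENNReal.ofReal b * nakanoModular p y := by
  unfold nakanoModular
  rw [← ENNReal.tsum_mul_left, ← ENNReal.tsum_mul_left, ← ENNReal.tsum_add]
  refine ENNReal.tsum_le_tsum fun n => ?_
  have hx := Real.rpow_nonneg (abs_nonneg (x n)) (p n)
  have hy := Real.rpow_nonneg (abs_nonneg (y n)) (p n)
  rw [← ENNReal.ofReal_mul ha, ← ENNReal.ofReal_mul hb,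
    ← ENNReal.ofReal_add (mul_nonneg ha hx) (mul_nonneg hb hy)]
  apply ENNReal.ofReal_le_ofReal
  have h1 : |(a • x + b • y) n| ≤ a * |x n| + b * |y n| := by
    have := abs_add_le (a * x n) (b * y n)
    simpa [abs_mul, abs_of_nonneg ha, abs_of_nonneg hb] using this
  have h2 := (convexOn_rpow (hp n)).2 (Set.mem_Ici.2 (abs_nonneg (x n)))
    (Set.mem_Ici.2 (abs_nonneg (y n))) ha hb hab
  simp only [smul_eq_mul] at h2
  exact (Real.rpow_le_rpow (abs_nonneg _) h1 (by linarith [hp n])).trans h2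

/-- If `x / ρ` and `y / σ` have modular at most `c`, then so does `(x + y) / (ρ + σ)`. -/
theorem nakanoModular_add_le {p : ℕ → ℝ} (hp : ∀ n, 1 ≤ p n) {x y : ℕ → ℝ} {ρ σ : ℝ}
    (hρ : 0 < ρ) (hσ : 0 < σ) {c : ℝ≥0∞} (hx : nakanoModular p (ρ⁻¹ • x) ≤ c)
    (hy : nakanoModular p (σ⁻¹ • y) ≤ c) : nakanoModular p ((ρ + σ)⁻¹ • (x + y)) ≤ c := by
  have hs : 0 < ρ + σ := add_pos hρ hσ
  have hab : ρ / (ρ + σ) + σ / (ρ + σ) = 1 := by field_simp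
  have ha : 0 ≤ ρ / (ρ + σ) := by positivity
  have hb : 0 ≤ σ / (ρ + σ) := by positivity
  have h := nakanoModular_convex hp (ρ⁻¹ • x) (σ⁻¹ • y) ha hb hab
  have e : (ρ / (ρ + σ)) • (ρ⁻¹ • x) + (σ / (ρ + σ)) • (σ⁻¹ • y) = (ρ + σ)⁻¹ • (x + y) := by
    ext n
    simp only [Pi.add_apply, Pi.smul_apply, smul_eq_mul]
    field_simp
  rw [e] at h
  calc _ ≤ _ := h
    _ ≤ ENNReal.ofReal (ρ / (ρ + σ)) * c + ENNReal.ofReal (σ / (ρ + σ)) * c := by gcongr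
    _ = c := by rw [← add_mul, ← ENNReal.ofReal_add ha hb, hab, ENNReal.ofReal_one, one_mul]

theorem MemNakano.add {p : ℕ → ℝ} (hp : ∀ n, 1 ≤ p n) {x y : ℕ → ℝ} (hx : MemNakano p x)
    (hy : MemNakano p y) : MemNakano p (x + y) := by
  obtain ⟨ρ, hρ, hx⟩ := hx
  obtain ⟨σ, hσ, hy⟩ := hy
  exact ⟨ρ + σ, add_pos hρ hσ, (nakanoModular_add_le hp hρ hσ (le_max_left _ _)
    (le_max_right _ _)).trans_lt (max_lt hx hy)⟩

theorem nakanoModular_zero {p : ℕ → ℝ} (hp : ∀ n, 1 ≤ p n) : nakanoModular p 0 = 0 := by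
  have h (n : ℕ) : (0 : ℝ) ^ p n = 0 := Real.zero_rpow (by linarith [hp n])
  simp [nakanoModular, h]

theorem memNakano_zero {p : ℕ → ℝ} (hp : ∀ n, 1 ≤ p n) : MemNakano p 0 :=
  ⟨1, one_pos, by simp [nakanoModular_zero hp]⟩

theorem nakanoModular_abs_smul (p x : ℕ → ℝ) (c : ℝ) :
    nakanoModular p (|c| • x) = nakanoModular p (c • x) := by
  simp [nakanoModular, abs_mul]

theorem nakano_inv_smul {c ρ : ℝ} (hc : c ≠ 0) (p x : ℕ → ℝ) :
    nakanoModular p ((|c| * ρ)⁻¹ • (c • x)) = nakanoModular p (ρ⁻¹ • x) := by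
  simp only [nakanoModular, Pi.smul_apply, smul_eq_mul]
  congr 1; ext n; congr 2
  have : |c| ≠ 0 := abs_ne_zero.2 hc
  rw [abs_mul, abs_mul, abs_mul, abs_inv, abs_mul, abs_abs, abs_inv]
  field_simp

theorem MemNakano.smul {p : ℕ → ℝ} (hp : ∀ n, 1 ≤ p n) {x : ℕ → ℝ} (c : ℝ)
    (hx : MemNakano p x) : MemNakano p (c • x) := by
  rcases eq_or_ne c 0 with rfl | hc
  · simpa using memNakano_zero hp
  · obtain ⟨ρ, hρ, hx⟩ := hx
    exact ⟨|c| * ρ, mul_pos (abs_pos.2 hc) hρ, by rwa [nakano_inv_smul hc]⟩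

/-- The underlying vector space of `ℓ_{pₙ}`, as a space of real sequences. -/
def nakanoSubmodule (p : ℕ → ℝ) (hp : ∀ n, 1 ≤ p n) : Submodule ℝ (ℕ → ℝ) where
  carrier := {x | MemNakano p x}
  add_mem' hx hy := MemNakano.add hp hx hy
  zero_mem' := memNakano_zero hp
  smul_mem' c _ hx := MemNakano.smul hp c hx

theorem nakanoNorm_set_nonempty {p : ℕ → ℝ} (hp : ∀ n, 1 ≤ p n) {x : ℕ → ℝ}
    (hx : MemNakano p x) : {ρ : ℝ | 0 < ρ ∧ nakanoModular p (ρ⁻¹ • x) ≤ 1}.Nonempty := by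
  obtain ⟨ρ, hρ, hx⟩ := hx
  set m := (nakanoModular p (ρ⁻¹ • x)).toReal with hm
  have hm0 : 0 ≤ m := ENNReal.toReal_nonneg
  have ht : 0 < 1 + m := by linarith
  refine ⟨(1 + m) * ρ, mul_pos ht hρ, ?_⟩
  have h1 : |(1 + m)⁻¹| ≤ 1 := by
    rw [abs_of_pos (inv_pos.2 ht)]
    exact inv_le_one_of_one_le₀ (by linarith)
  have h := nakanoModular_smul_le hp (ρ⁻¹ • x) h1
  rw [smul_smul, ← mul_inv, ← ENNReal.ofReal_toReal hx.ne, ← hm,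
    ← ENNReal.ofReal_mul (abs_nonneg _), abs_of_pos (inv_pos.2 ht)] at h
  refine h.trans ?_
  rw [ENNReal.ofReal_le_one, inv_mul_le_iff₀ ht]
  linarith

theorem nakanoNorm_bddBelow (p x : ℕ → ℝ) :
    BddBelow {ρ : ℝ | 0 < ρ ∧ nakanoModular p (ρ⁻¹ • x) ≤ 1} :=
  ⟨0, fun _ h => h.1.le⟩

theorem nakanoNorm_nonneg (p x : ℕ → ℝ) : 0 ≤ nakanoNorm p x :=
  Real.sInf_nonneg fun _ h => h.1.le

theorem abs_le_nakanoNorm {p : ℕ → ℝ} (hp : ∀ n, 1 ≤ p n) {x : ℕ → ℝ}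
    (hx : MemNakano p x) (n : ℕ) : |x n| ≤ nakanoNorm p x := by
  refine le_csInf (nakanoNorm_set_nonempty hp hx) fun ρ h => ?_
  have h1 : ENNReal.ofReal (|(ρ⁻¹ • x) n| ^ p n) ≤ 1 := (ENNReal.le_tsum n).trans h.2
  rw [ENNReal.ofReal_le_one, Pi.smul_apply, smul_eq_mul, abs_mul, abs_inv, abs_of_pos h.1] at h1
  by_contra hlt
  have h2 : 1 < ρ⁻¹ * |x n| := by
    rw [lt_inv_mul_iff₀ h.1, mul_one]; exact not_le.1 hlt
  exact absurd (Real.one_lt_rpow h2 (by linarith [hp n])) (not_lt.2 h1)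

theorem nakanoNorm_add_le {p : ℕ → ℝ} (hp : ∀ n, 1 ≤ p n) {x y : ℕ → ℝ} (hx : MemNakano p x)
    (hy : MemNakano p y) : nakanoNorm p (x + y) ≤ nakanoNorm p x + nakanoNorm p y := by
  rw [← sub_le_iff_le_add]
  refine le_csInf (nakanoNorm_set_nonempty hp hx) fun ρ hρ => ?_
  rw [sub_le_iff_le_add, ← sub_le_iff_le_add']
  refine le_csInf (nakanoNorm_set_nonempty hp hy) fun σ hσ => ?_
  rw [sub_le_iff_le_add']
  exact csInf_le (nakanoNorm_bddBelow _ _)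
    ⟨add_pos hρ.1 hσ.1, nakanoModular_add_le hp hρ.1 hσ.1 hρ.2 hσ.2⟩

theorem nakanoNorm_smul_le {p : ℕ → ℝ} (hp : ∀ n, 1 ≤ p n) {x : ℕ → ℝ} {c : ℝ} (hc : c ≠ 0)
    (hx : MemNakano p x) : nakanoNorm p (c • x) ≤ |c| * nakanoNorm p x := by
  have hc' := abs_pos.2 hc
  rw [← inv_mul_le_iff₀ hc']
  refine le_csInf (nakanoNorm_set_nonempty hp hx) fun ρ hρ => ?_
  rw [inv_mul_le_iff₀ hc']
  exact csInf_le (nakanoNorm_bddBelow _ _)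
    ⟨mul_pos hc' hρ.1, by rw [nakano_inv_smul hc]; exact hρ.2⟩

theorem nakanoNorm_zero {p : ℕ → ℝ} (hp : ∀ n, 1 ≤ p n) : nakanoNorm p 0 = 0 := by
  refine le_antisymm (le_of_forall_pos_le_add fun ε hε => ?_) (nakanoNorm_nonneg _ _)
  rw [zero_add]
  exact csInf_le (nakanoNorm_bddBelow _ _) ⟨hε, by simp [nakanoModular_zero hp]⟩

theorem nakanoNorm_smul {p : ℕ → ℝ} (hp : ∀ n, 1 ≤ p n) {x : ℕ → ℝ} (c : ℝ)
    (hx : MemNakano p x) : nakanoNorm p (c • x) = |c| * nakanoNorm p x := by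
  rcases eq_or_ne c 0 with rfl | hc
  · simp [nakanoNorm_zero hp]
  · refine le_antisymm (nakanoNorm_smul_le hp hc hx) ?_
    have h := nakanoNorm_smul_le hp (inv_ne_zero hc) (MemNakano.smul hp c hx)
    rw [smul_smul, inv_mul_cancel₀ hc, one_smul, abs_inv] at h
    rwa [le_inv_mul_iff₀ (abs_pos.2 hc)] at h

/-- The Nakano sequence space `ℓ_{pₙ}` (it carries the Luxemburg--Nakano norm, and not the
topology of pointwise convergence). -/
def NakanoSpace (p : ℕ → ℝ) (hp : ∀ n, 1 ≤ p n) : Type :=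
  nakanoSubmodule p hp

namespace NakanoSpace

variable {p : ℕ → ℝ} {hp : ∀ n, 1 ≤ p n}

instance : AddCommGroup (NakanoSpace p hp) :=
  inferInstanceAs (AddCommGroup (nakanoSubmodule p hp))

instance : Module ℝ (NakanoSpace p hp) :=
  inferInstanceAs (Module ℝ (nakanoSubmodule p hp))

instance : Norm (NakanoSpace p hp) :=
  ⟨fun x => nakanoNorm p x.1⟩

theorem core : NormedSpace.Core ℝ (NakanoSpace p hp) where
  norm_nonneg x := nakanoNorm_nonneg p x.1
  norm_smul c x := nakanoNorm_smul hp c x.2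
  norm_triangle x y := nakanoNorm_add_le hp x.2 y.2
  norm_eq_zero_iff x := by
    constructor
    · intro h
      apply Subtype.ext
      funext n
      have h1 := abs_le_nakanoNorm hp x.2 n
      have h2 : nakanoNorm p x.1 = 0 := h
      rw [h2] at h1
      exact abs_nonpos_iff.1 h1
    · rintro rfl
      exact nakanoNorm_zero hp

instance : NormedAddCommGroup (NakanoSpace p hp) :=
  NormedAddCommGroup.ofCore core

instance : NormedSpace ℝ (NakanoSpace p hp) :=
  NormedSpace.ofCore core

end NakanoSpace

/-- `lam` belongs to the space of pointwise multipliers `M(ℓ_{pₙ}, ℓ_{qₙ})`. -/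
def IsNakanoMultiplier (p q lam : ℕ → ℝ) : Prop :=
  ∀ x : ℕ → ℝ, MemNakano p x → MemNakano q (lam * x)

/-- The multiplication operator `M_lam : ℓ_{pₙ} → ℓ_{qₙ}`, `x ↦ (lamₙ xₙ)ₙ`. -/
def nakanoMul {p q : ℕ → ℝ} (hp : ∀ n, 1 ≤ p n) (hq : ∀ n, 1 ≤ q n) {lam : ℕ → ℝ}
    (hlam : IsNakanoMultiplier p q lam) : NakanoSpace p hp →ₗ[ℝ] NakanoSpace q hq where
  toFun x := ⟨lam * x.1, hlam x.1 x.2⟩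
  map_add' x y := Subtype.ext (mul_add lam x.1 y.1)
  map_smul' c x := Subtype.ext (mul_smul_comm c lam x.1)

/-- The exponent `rₙ` with `1 / rₙ = 1 / qₙ - 1 / pₙ`; only used where `qₙ < pₙ`. -/
def nakanoExponent (p q : ℕ → ℝ) (n : ℕ) : ℝ :=
  (1 / q n - 1 / p n)⁻¹

end

/-! ### Modular and norm: order, Fatou property, tails. -/

section Modular

variable {p q : ℕ → ℝ}

/-! Since `q` is bounded, every element of `ℓ_q` has tails small in norm. Hence `M_λ` is compact
exactly when the tails of `λ` vanish in multiplier norm (`NakanoTailVanishing`): a finite net makes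
the tails of the image of the unit ball uniformly small, and conversely small tails make `M_λ` a
norm limit of finite-rank truncations.

Up to factors of 2, multipliers are measured by the modular of `ℓ_r` where `q < p` and by the sup
norm where `q = p`. Young's inequality (`nakanoModular_mul_le`) gives one direction, testing on the
extremal `|μ| ^ (q / (p - q))` (`tsum_nakanoTerm_half_le`) the other. So tails vanish iff `∑ (l
|λ_n|) ^ r_n < ∞` for all `l > 1` and `λ → 0` on `{q = p}`.

Finally, a multiplier has `∑ (c |λ_n|) ^ r_n < ∞` for some `c > 0`. Changing `c` to `l` costs a
bounded factor where `r_n` is bounded, so only large `r_n` matter; this turns finiteness into the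
limit of truncated sums. -/

theorem nakanoModular_mono (hp : ∀ n, 1 ≤ p n) {x y : ℕ → ℝ} (h : ∀ n, |x n| ≤ |y n|) :
    nakanoModular p x ≤ nakanoModular p y :=
  ENNReal.tsum_le_tsum fun n => ENNReal.ofReal_le_ofReal
    (Real.rpow_le_rpow (abs_nonneg _) (h n) (by linarith [hp n]))

theorem nakanoNorm_le {x : ℕ → ℝ} {ρ : ℝ} (hρ : 0 < ρ)
    (h : nakanoModular p (ρ⁻¹ • x) ≤ 1) : nakanoNorm p x ≤ ρ :=
  csInf_le (nakanoNorm_bddBelow p x) ⟨hρ, h⟩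

theorem nakanoModular_inv_smul_le_one (hp : ∀ n, 1 ≤ p n) {x : ℕ → ℝ} (hx : MemNakano p x)
    {ρ : ℝ} (h : nakanoNorm p x < ρ) : nakanoModular p (ρ⁻¹ • x) ≤ 1 := by
  obtain ⟨σ, ⟨hσ, hσ'⟩, hlt⟩ := exists_lt_of_csInf_lt (nakanoNorm_set_nonempty hp hx) h
  refine (nakanoModular_mono hp fun n => ?_).trans hσ'
  simp only [Pi.smul_apply, smul_eq_mul, abs_mul, abs_inv, abs_of_pos hσ,
    abs_of_pos (hσ.trans hlt)]
  gcongr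

theorem nakanoNorm_mono (hp : ∀ n, 1 ≤ p n) {x y : ℕ → ℝ} (hy : MemNakano p y)
    (h : ∀ n, |x n| ≤ |y n|) : nakanoNorm p x ≤ nakanoNorm p y := by
  refine le_of_forall_gt_imp_ge_of_dense fun ρ hρ => ?_
  refine nakanoNorm_le ((nakanoNorm_nonneg p y).trans_lt hρ) ?_
  refine (nakanoModular_mono hp fun n => ?_).trans (nakanoModular_inv_smul_le_one hp hy hρ)
  simp only [Pi.smul_apply, smul_eq_mul, abs_mul]
  exact mul_le_mul_of_nonneg_left (h n) (abs_nonneg _)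

theorem MemNakano.mono (hp : ∀ n, 1 ≤ p n) {x y : ℕ → ℝ} (hy : MemNakano p y)
    (h : ∀ n, |x n| ≤ |y n|) : MemNakano p x := by
  obtain ⟨ρ, hρ, hy⟩ := hy
  refine ⟨ρ, hρ, (nakanoModular_mono hp fun n => ?_).trans_lt hy⟩
  simp only [Pi.smul_apply, smul_eq_mul, abs_mul]
  exact mul_le_mul_of_nonneg_left (h n) (abs_nonneg _)

theorem memNakano_of_modular_lt_top {x : ℕ → ℝ} (h : nakanoModular p x < ∞) :
    MemNakano p x :=
  ⟨1, one_pos, by simpa using h⟩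

theorem nakanoModular_eq_sum (hp : ∀ n, 1 ≤ p n) {x : ℕ → ℝ} {F : Finset ℕ}
    (h : ∀ n ∉ F, x n = 0) :
    nakanoModular p x = ∑ n ∈ F, ENNReal.ofReal (|x n| ^ p n) := by
  refine tsum_eq_sum fun n hn => ?_
  rw [h n hn, abs_zero, Real.zero_rpow (by linarith [hp n]), ENNReal.ofReal_zero]

theorem memNakano_of_finite (hp : ∀ n, 1 ≤ p n) {x : ℕ → ℝ} {F : Finset ℕ}
    (h : ∀ n ∉ F, x n = 0) : MemNakano p x :=
  memNakano_of_modular_lt_top <| by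
    rw [nakanoModular_eq_sum hp h]
    exact ENNReal.sum_lt_top.2 fun n _ => ENNReal.ofReal_lt_top

/-- Fatou's lemma for the modular. -/
theorem nakanoModular_le_of_tendsto (hp : ∀ n, 1 ≤ p n) {ι : Type*} {l : Filter ι} [l.NeBot]
    {u : ι → ℕ → ℝ} {v : ℕ → ℝ} (hu : ∀ n, Tendsto (fun k => u k n) l (𝓝 (v n))) {c : ℝ≥0∞}
    (h : ∀ᶠ k in l, nakanoModular p (u k) ≤ c) : nakanoModular p v ≤ c := by
  refine ENNReal.summable.tsum_le_of_sum_le fun F => ?_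
  refine le_of_tendsto (x := l)
    (f := fun k => ∑ n ∈ F, ENNReal.ofReal (|u k n| ^ p n)) ?_ ?_
  · refine tendsto_finsetSum _ fun n _ => ENNReal.tendsto_ofReal ?_
    exact (hu n).abs.rpow_const (Or.inr (by linarith [hp n]))
  · filter_upwards [h] with k hk
    exact (ENNReal.sum_le_tsum F).trans hk

/-- A bounded exponent satisfies the `Δ₂` condition. -/
theorem nakanoModular_smul_lt_top (hq : ∀ n, 1 ≤ q n) (hbdd : BddAbove (Set.range q))
    {x : ℕ → ℝ} (hx : nakanoModular q x < ∞) (c : ℝ) : nakanoModular q (c • x) < ∞ := by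
  obtain ⟨Q, hQ⟩ := hbdd
  have hQ n : q n ≤ Q := hQ (Set.mem_range_self n)
  have hC : 1 ≤ max 1 |c| := le_max_left _ _
  refine (?_ : _ ≤ ENNReal.ofReal (max 1 |c| ^ Q) * nakanoModular q x).trans_lt
    (ENNReal.mul_lt_top ENNReal.ofReal_lt_top hx)
  unfold nakanoModular
  rw [← ENNReal.tsum_mul_left]
  refine ENNReal.tsum_le_tsum fun n => ?_
  rw [← ENNReal.ofReal_mul (by positivity)]
  refine ENNReal.ofReal_le_ofReal ?_
  rw [Pi.smul_apply, smul_eq_mul, abs_mul, Real.mul_rpow (abs_nonneg _) (abs_nonneg _)]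
  gcongr
  calc |c| ^ q n ≤ max 1 |c| ^ q n :=
        Real.rpow_le_rpow (abs_nonneg _) (le_max_right _ _) (by linarith [hq n])
    _ ≤ max 1 |c| ^ Q := Real.rpow_le_rpow_of_exponent_le hC (hQ n)

theorem tendsto_tsum_indicator_Ici {f : ℕ → ℝ≥0∞} (hf : ∑' n, f n ≠ ∞) :
    Tendsto (fun N => ∑' n, (Set.Ici N).indicator f n) atTop (𝓝 0) := by
  refine (ENNReal.tendsto_sum_nat_add f hf).congr fun N => ?_
  symm
  rw [← ENNReal.summable.sum_add_tsum_nat_add' (f := (Set.Ici N).indicator f) (k := N)]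
  rw [Finset.sum_eq_zero, zero_add]
  · exact tsum_congr fun k => Set.indicator_of_mem (by simp) f
  · intro n hn
    exact Set.indicator_of_notMem (by simpa using hn) f

theorem smul_indicator_eq (c : ℝ) (s : Set ℕ) (x : ℕ → ℝ) :
    c • s.indicator x = s.indicator (c • x) := by
  ext n
  by_cases hn : n ∈ s <;> simp [hn]

theorem nakanoModular_indicator (hp : ∀ n, 1 ≤ p n) (s : Set ℕ) (x : ℕ → ℝ) :
    nakanoModular p (s.indicator x) =
      ∑' n, s.indicator (fun n => ENNReal.ofReal (|x n| ^ p n)) n := by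
  refine tsum_congr fun n => ?_
  by_cases hn : n ∈ s
  · simp [hn]
  · simp [hn, Real.zero_rpow (by linarith [hp n] : p n ≠ 0)]

/-- By `Δ₂` the modular of `x / ε` is finite for every `ε`, so some tail of that series is at most
1. -/
theorem exists_nakanoNorm_indicator_le (hq : ∀ n, 1 ≤ q n) (hbdd : BddAbove (Set.range q))
    {x : ℕ → ℝ} (hx : MemNakano q x) {ε : ℝ} (hε : 0 < ε) :
    ∃ N, nakanoNorm q ((Set.Ici N).indicator x) ≤ ε := by
  obtain ⟨ρ, hρ, hx⟩ := hx
  have h := nakanoModular_smul_lt_top hq hbdd hx (ε⁻¹ * ρ)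
  rw [smul_smul, mul_assoc, mul_inv_cancel₀ hρ.ne', mul_one] at h
  obtain ⟨N, hN⟩ := ((tendsto_tsum_indicator_Ici h.ne).eventually
    (eventually_le_nhds (show (0 : ℝ≥0∞) < 1 by simp))).exists
  refine ⟨N, nakanoNorm_le hε ?_⟩
  rw [smul_indicator_eq, nakanoModular_indicator hq]
  exact hN

end Modular

/-! ### Coordinate functionals and completeness. -/

namespace NakanoSpace

variable {p : ℕ → ℝ} {hp : ∀ n, 1 ≤ p n}

theorem norm_def (x : NakanoSpace p hp) : ‖x‖ = nakanoNorm p x.1 := rfl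

theorem abs_apply_le_norm (x : NakanoSpace p hp) (n : ℕ) : |x.1 n| ≤ ‖x‖ :=
  abs_le_nakanoNorm hp x.2 n

/-- Evaluation at `n` as a continuous linear functional. -/
noncomputable def eval (hp : ∀ n, 1 ≤ p n) (n : ℕ) : NakanoSpace p hp →L[ℝ] ℝ :=
  LinearMap.mkContinuous
    { toFun := fun x => x.1 n
      map_add' := fun _ _ => rfl
      map_smul' := fun _ _ => rfl } 1 fun x => by
        rw [one_mul]; exact abs_apply_le_norm x n

/-- Coordinates of a Cauchy sequence converge, and Fatou passes the modular form of the Cauchy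
estimate to the limit. Completeness is needed for the closed graph theorem and for closedness of the
compact operators. -/
instance : CompleteSpace (NakanoSpace p hp) := by
  refine Metric.complete_of_cauchySeq_tendsto fun u hu => ?_
  have hc (n : ℕ) : ∃ a, Tendsto (fun k => (u k).1 n) atTop (𝓝 a) :=
    cauchySeq_tendsto_of_complete ((eval hp n).uniformContinuous.comp_cauchySeq hu)
  choose v hv using hc
  have key (ε : ℝ) (hε : 0 < ε) : ∃ K, ∀ j ≥ K,
      nakanoModular p (ε⁻¹ • ((u j).1 - v)) ≤ 1 := by
    obtain ⟨K, hK⟩ := Metric.cauchySeq_iff.1 hu ε hε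
    refine ⟨K, fun j hj => ?_⟩
    refine nakanoModular_le_of_tendsto (l := atTop) hp
      (u := fun k => ε⁻¹ • ((u j).1 - (u k).1)) (fun n => ?_) ?_
    · exact ((hv n).const_sub _).const_mul _
    · filter_upwards [eventually_ge_atTop K] with k hk
      have h := hK j hj k hk
      rw [dist_eq_norm] at h
      exact nakanoModular_inv_smul_le_one hp (u j - u k).2 h
  have hmem : MemNakano p v := by
    obtain ⟨K, hK⟩ := key 1 one_pos
    have h1 : MemNakano p ((u K).1 - v) :=
      ⟨1, one_pos, (hK K le_rfl).trans_lt ENNReal.one_lt_top⟩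
    have h2 := MemNakano.add hp (u K).2 (h1.smul hp (-1))
    convert h2 using 1
    ext n; simp
  let w : NakanoSpace p hp := ⟨v, hmem⟩
  refine ⟨w, Metric.tendsto_atTop.2 fun ε hε => ?_⟩
  obtain ⟨K, hK⟩ := key (ε / 2) (half_pos hε)
  refine ⟨K, fun j hj => ?_⟩
  rw [dist_eq_norm]
  exact (nakanoNorm_le (half_pos hε) (hK j hj)).trans_lt (half_lt_self hε)

end NakanoSpace

/-! ### Compactness versus uniformly small tails. -/

section Compact

variable {p q lam : ℕ → ℝ} {hp : ∀ n, 1 ≤ p n} {hq : ∀ n, 1 ≤ q n}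

/-- Closed graph theorem: norm convergence forces coordinatewise convergence, which identifies the
limit. -/
theorem continuous_nakanoMul (hlam : IsNakanoMultiplier p q lam) :
    Continuous (nakanoMul hp hq hlam) := by
  refine LinearMap.continuous_of_seq_closed_graph _ fun u x y hu hy => ?_
  refine Subtype.ext (funext fun n => ?_)
  have h1 := ((NakanoSpace.eval hq n).continuous.tendsto y).comp hy
  have h2 := (((NakanoSpace.eval hp n).continuous.tendsto x).comp hu).const_mul (lam n)
  exact tendsto_nhds_unique h1 h2

/-- The embedding of `ℝᴺ` in `ℓ_{qₙ}` as the sequences supported in `{0, …, N - 1}`. -/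
noncomputable def nakanoEmbed (hq : ∀ n, 1 ≤ q n) (N : ℕ) :
    (Fin N → ℝ) →ₗ[ℝ] NakanoSpace q hq where
  toFun c := ⟨fun n => if h : n < N then c ⟨n, h⟩ else 0,
    memNakano_of_finite hq (F := Finset.range N) fun n hn =>
      dif_neg (by simpa using hn)⟩
  map_add' c d := Subtype.ext <| funext fun n => by
    change _ = (dite _ _ _ : ℝ) + dite _ _ _
    by_cases h : n < N <;> simp [h]
  map_smul' a c := Subtype.ext <| funext fun n => by
    change _ = a * (dite _ _ _ : ℝ)
    by_cases h : n < N <;> simp [h]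

theorem isCompactOperator_nakanoMul_of_tail (hlam : IsNakanoMultiplier p q lam)
    (h : ∀ ε > 0, ∃ N, ∀ x : NakanoSpace p hp,
      nakanoNorm q ((Set.Ici N).indicator (lam * x.1)) ≤ ε * ‖x‖) :
    IsCompactOperator (nakanoMul hp hq hlam) := by
  let T : NakanoSpace p hp →L[ℝ] NakanoSpace q hq := ⟨nakanoMul hp hq hlam,
    continuous_nakanoMul hlam⟩
  -- Truncation to the first `N` coordinates, factored through `ℝᴺ` so that compactness is
  -- automatic.
  let H (N : ℕ) : NakanoSpace q hq →L[ℝ] NakanoSpace q hq :=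
    (nakanoEmbed hq N).toContinuousLinearMap ∘L
      ContinuousLinearMap.pi fun i : Fin N => NakanoSpace.eval hq i
  have hH (N : ℕ) (x : NakanoSpace p hp) :
      ((T - H N ∘L T) x).1 = (Set.Ici N).indicator (lam * x.1) := by
    funext n
    change lam n * x.1 n - (dite _ _ _ : ℝ) = _
    by_cases hn : n < N
    · rw [dif_pos hn, Set.indicator_of_notMem (by simpa using hn)]
      exact sub_self _
    · rw [dif_neg hn, Set.indicator_of_mem (by simpa using hn)]
      exact sub_zero _
  have hcpt (N : ℕ) : IsCompactOperator (H N ∘L T) :=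
    (isCompactOperator_of_locallyCompactSpace_rng
      (nakanoEmbed hq N).toContinuousLinearMap).comp_clm
      ((ContinuousLinearMap.pi fun i : Fin N => NakanoSpace.eval hq i) ∘L T)
  have hclosed := isClosed_setOfPred_isCompactOperator (σ₁₂ := RingHom.id ℝ)
    (M₁ := NakanoSpace p hp) (M₂ := NakanoSpace q hq)
  have hT : T ∈ closure {f : NakanoSpace p hp →L[ℝ] NakanoSpace q hq | IsCompactOperator f} := by
    refine Metric.mem_closure_iff.2 fun ε hε => ?_
    obtain ⟨N, hN⟩ := h (ε / 2) (half_pos hε)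
    refine ⟨H N ∘L T, hcpt N, ?_⟩
    rw [dist_eq_norm]
    refine (ContinuousLinearMap.opNorm_le_bound _ (half_pos hε).le fun x => ?_).trans_lt
      (half_lt_self hε)
    rw [NakanoSpace.norm_def, hH]
    exact hN x
  have := hclosed.closure_eq ▸ hT
  exact this

/-- Cover the image of the unit ball by finitely many `ε / 2`-balls; beyond a common index every
centre has tail at most `ε / 2`. -/
theorem IsCompactOperator.exists_nakano_tail_le (hbdd : BddAbove (Set.range q))
    {hlam : IsNakanoMultiplier p q lam} (h : IsCompactOperator (nakanoMul hp hq hlam))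
    {ε : ℝ} (hε : 0 < ε) : ∃ N, ∀ x : NakanoSpace p hp, ‖x‖ ≤ 1 →
      nakanoNorm q ((Set.Ici N).indicator (lam * x.1)) ≤ ε := by
  obtain ⟨K, hK, hsub⟩ := h.image_closedBall_subset_compact 1
  obtain ⟨t, -, ht, hcov⟩ := hK.finite_cover_balls (half_pos hε)
  choose M hM using fun y : NakanoSpace q hq =>
    exists_nakanoNorm_indicator_le hq hbdd y.2 (half_pos hε)
  obtain ⟨N, hN⟩ := (ht.image M).bddAbove
  refine ⟨N, fun x hx => ?_⟩
  have hxK : nakanoMul hp hq hlam x ∈ K :=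
    hsub ⟨x, by simpa using hx, rfl⟩
  obtain ⟨y, hy, hxy⟩ := Set.mem_iUnion₂.1 (hcov hxK)
  rw [Metric.mem_ball, dist_eq_norm] at hxy
  set z := nakanoMul hp hq hlam x - y with hz
  have hzeq : lam * x.1 = z.1 + y.1 := by
    have : nakanoMul hp hq hlam x = z + y := by rw [hz, sub_add_cancel]
    exact congrArg Subtype.val this
  have hind (s : Set ℕ) (w : ℕ → ℝ) (n : ℕ) : |s.indicator w n| ≤ |w n| := by
    by_cases hn : n ∈ s <;> simp [hn]
  rw [hzeq, Set.indicator_add']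
  refine (nakanoNorm_add_le hq (z.2.mono hq (hind _ _)) (y.2.mono hq (hind _ _))).trans ?_
  have h1 : nakanoNorm q ((Set.Ici N).indicator z.1) ≤ ε / 2 :=
    (nakanoNorm_mono hq z.2 (hind _ _)).trans hxy.le
  have h2 : nakanoNorm q ((Set.Ici N).indicator y.1) ≤ ε / 2 := by
    refine (nakanoNorm_mono hq (y.2.mono hq (hind (Set.Ici (M y)) _)) fun n => ?_).trans (hM y)
    have hMN : M y ≤ N := hN ⟨y, hy, rfl⟩
    by_cases hn : n ∈ Set.Ici N
    · rw [Set.indicator_of_mem hn, Set.indicator_of_mem (Set.Ici_subset_Ici.2 hMN hn)]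
    · rw [Set.indicator_of_notMem hn, abs_zero]; exact abs_nonneg _
  linarith

end Compact

/-! ### Pointwise Young inequality and its extremal. -/

section Exponent

variable {p q : ℕ → ℝ}

theorem nakanoExponent_eq (hp : ∀ n, 1 ≤ p n) (hq : ∀ n, 1 ≤ q n) (n : ℕ) :
    nakanoExponent p q n = p n * q n / (p n - q n) := by
  have h1 : p n ≠ 0 := by linarith [hp n]
  have h2 : q n ≠ 0 := by linarith [hq n]
  rw [nakanoExponent, div_sub_div _ _ h2 h1, inv_div]
  ring

theorem one_le_nakanoExponent (hp : ∀ n, 1 ≤ p n) (hq : ∀ n, 1 ≤ q n) {n : ℕ}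
    (h : q n < p n) : 1 ≤ nakanoExponent p q n := by
  rw [nakanoExponent_eq hp hq, one_le_div (by linarith)]
  nlinarith [hp n, hq n]

/-- If `M` is the right side, then `a ≤ M ^ (1/r)` and `x ≤ M ^ (1/p)`, and these exponents add up
to `1/q`. -/
theorem mul_rpow_le_rpow_nakanoExponent_add (hp : ∀ n, 1 ≤ p n) (hq : ∀ n, 1 ≤ q n) {n : ℕ}
    (h : q n < p n) {a x : ℝ} (ha : 0 ≤ a) (hx : 0 ≤ x) :
    (a * x) ^ q n ≤ a ^ nakanoExponent p q n + x ^ p n := by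
  have hr := one_le_nakanoExponent hp hq h
  have hp0 : p n ≠ 0 := by linarith [hp n]
  have hq0 : q n ≠ 0 := by linarith [hq n]
  set r := nakanoExponent p q n with hrdef
  have hr0 : r ≠ 0 := by linarith
  have har := Real.rpow_nonneg ha r
  have hxp := Real.rpow_nonneg hx (p n)
  set M := a ^ r + x ^ p n with hM
  have hM0 : 0 ≤ M := by positivity
  have h1 : a ≤ M ^ r⁻¹ := by
    calc a = (a ^ r) ^ r⁻¹ := (Real.rpow_rpow_inv ha hr0).symm
      _ ≤ M ^ r⁻¹ := Real.rpow_le_rpow har (by linarith) (by positivity)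
  have h2 : x ≤ M ^ (p n)⁻¹ := by
    calc x = (x ^ p n) ^ (p n)⁻¹ := (Real.rpow_rpow_inv hx hp0).symm
      _ ≤ M ^ (p n)⁻¹ := Real.rpow_le_rpow hxp (by linarith) (inv_nonneg.2 (by linarith [hp n]))
  have h3 : r⁻¹ + (p n)⁻¹ = (q n)⁻¹ := by
    rw [hrdef, nakanoExponent, inv_inv]; ring
  calc (a * x) ^ q n ≤ (M ^ r⁻¹ * M ^ (p n)⁻¹) ^ q n :=
        Real.rpow_le_rpow (by positivity) (by gcongr) (by linarith [hq n])
    _ = M := by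
        rw [← Real.rpow_add' hM0 (by rw [h3]; exact inv_ne_zero hq0), h3,
          Real.rpow_inv_rpow hM0 hq0]

/-- With the next lemma: for `x = a ^ (q / (p - q))` both `x ^ p` and `(a x) ^ q` equal `a ^ r`, so
this `x` is the natural test element. -/
theorem rpow_rpow_eq_nakanoExponent (hp : ∀ n, 1 ≤ p n) (hq : ∀ n, 1 ≤ q n) {n : ℕ} {a : ℝ}
    (ha : 0 ≤ a) : (a ^ (q n / (p n - q n))) ^ p n = a ^ nakanoExponent p q n := by
  rw [← Real.rpow_mul ha, nakanoExponent_eq hp hq]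
  congr 1; ring

theorem mul_rpow_rpow_eq_nakanoExponent (hp : ∀ n, 1 ≤ p n) (hq : ∀ n, 1 ≤ q n) {n : ℕ}
    (h : q n < p n) {a : ℝ} (ha : 0 ≤ a) :
    (a * a ^ (q n / (p n - q n))) ^ q n = a ^ nakanoExponent p q n := by
  have h0 : 0 < p n - q n := by linarith
  have h1 : 0 < 1 + q n / (p n - q n) := by
    have := hq n
    positivity
  have h2 : a * a ^ (q n / (p n - q n)) = a ^ (1 + q n / (p n - q n)) := by
    rw [Real.rpow_add' ha h1.ne', Real.rpow_one]
  rw [h2, ← Real.rpow_mul ha, nakanoExponent_eq hp hq]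
  congr 1
  field_simp
  ring

end Exponent

/-! ### Multipliers and the modular of `ℓ_r`. -/

section Multiplier

variable {p q : ℕ → ℝ}

/-- The `n`-th term `|μₙ| ^ rₙ` of the modular of `ℓ_{rₙ}`, set to zero where `pₙ ≤ qₙ`. -/
noncomputable def nakanoTerm (p q mu : ℕ → ℝ) (n : ℕ) : ℝ≥0∞ :=
  {n | q n < p n}.indicator (fun n => ENNReal.ofReal (|mu n| ^ nakanoExponent p q n)) n

theorem nakanoTerm_of_lt {mu : ℕ → ℝ} {n : ℕ} (h : q n < p n) :
    nakanoTerm p q mu n = ENNReal.ofReal (|mu n| ^ nakanoExponent p q n) :=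
  Set.indicator_of_mem (s := {n | q n < p n}) h _

theorem nakanoTerm_of_not_lt {mu : ℕ → ℝ} {n : ℕ} (h : ¬ q n < p n) :
    nakanoTerm p q mu n = 0 :=
  Set.indicator_of_notMem (s := {n | q n < p n}) h _

theorem nakanoTerm_lt_top (mu : ℕ → ℝ) (n : ℕ) : nakanoTerm p q mu n < ∞ := by
  by_cases h : q n < p n
  · rw [nakanoTerm_of_lt h]; exact ENNReal.ofReal_lt_top
  · rw [nakanoTerm_of_not_lt h]; simp

theorem abs_le_one_of_modular_mul_le (hp : ∀ n, 1 ≤ p n) (hq : ∀ n, 1 ≤ q n) {mu : ℕ → ℝ}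
    (H : ∀ x, nakanoModular p x ≤ 1 → nakanoModular q (mu * x) ≤ 1) (n : ℕ) : |mu n| ≤ 1 := by
  have h1 : nakanoModular p (Pi.single n 1) ≤ 1 := by
    rw [nakanoModular_eq_sum hp (F := {n}) fun m hm => Pi.single_eq_of_ne (by simpa using hm) _]
    simp
  have h2 : ENNReal.ofReal (|(mu * (Pi.single n 1 : ℕ → ℝ)) n| ^ q n) ≤ 1 :=
    (ENNReal.le_tsum n).trans (H _ h1)
  rw [Pi.mul_apply, Pi.single_eq_same, mul_one, ENNReal.ofReal_le_one] at h2
  by_contra hlt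
  exact absurd (Real.one_lt_rpow (not_le.1 hlt) (by linarith [hq n])) (not_lt.2 h2)

/-- A self-improving bound. The test element `x` for `mu / 2` on `F` and its image `(mu / 2) * x`
both have modular equal to the sum. Once the sum is at most 1, `H` applies to `x`, and convexity
gains the factor `1 / 2`. -/
theorem sum_nakanoTerm_half_le (hp : ∀ n, 1 ≤ p n) (hq : ∀ n, 1 ≤ q n) {mu : ℕ → ℝ}
    (H : ∀ x, nakanoModular p x ≤ 1 → nakanoModular q (mu * x) ≤ 1) {F : Finset ℕ}
    (hF : ∑ n ∈ F, nakanoTerm p q ((1 / 2 : ℝ) • mu) n ≤ 1) :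
    ∑ n ∈ F, nakanoTerm p q ((1 / 2 : ℝ) • mu) n ≤ ENNReal.ofReal (1 / 2) := by
  classical
  set nu : ℕ → ℝ := (1 / 2 : ℝ) • mu with hnu
  let x : ℕ → ℝ := fun n => if n ∈ F ∧ q n < p n then |nu n| ^ (q n / (p n - q n)) else 0
  have hx0 : ∀ n ∉ F, x n = 0 := fun n hn => if_neg fun h => hn h.1
  have hxm : nakanoModular p x = ∑ n ∈ F, nakanoTerm p q nu n := by
    rw [nakanoModular_eq_sum hp hx0]
    refine Finset.sum_congr rfl fun n hn => ?_
    by_cases h : q n < p n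
    · rw [nakanoTerm_of_lt h, show x n = _ from if_pos ⟨hn, h⟩,
        abs_of_nonneg (Real.rpow_nonneg (abs_nonneg _) _),
        rpow_rpow_eq_nakanoExponent hp hq (abs_nonneg _)]
    · rw [nakanoTerm_of_not_lt h, show x n = 0 from if_neg fun h' => h h'.2, abs_zero,
        Real.zero_rpow (by linarith [hp n]), ENNReal.ofReal_zero]
  have hxq : nakanoModular q (nu * x) = ∑ n ∈ F, nakanoTerm p q nu n := by
    rw [nakanoModular_eq_sum hq (F := F) fun n hn => by rw [Pi.mul_apply, hx0 n hn, mul_zero]]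
    refine Finset.sum_congr rfl fun n hn => ?_
    by_cases h : q n < p n
    · rw [nakanoTerm_of_lt h, Pi.mul_apply, show x n = _ from if_pos ⟨hn, h⟩, abs_mul,
        abs_of_nonneg (Real.rpow_nonneg (abs_nonneg _) _),
        mul_rpow_rpow_eq_nakanoExponent hp hq h (abs_nonneg _)]
    · rw [nakanoTerm_of_not_lt h, Pi.mul_apply, show x n = 0 from if_neg fun h' => h h'.2,
        mul_zero, abs_zero, Real.zero_rpow (by linarith [hq n]), ENNReal.ofReal_zero]
  have h1 := nakanoModular_smul_le hq (mu * x) (c := 1 / 2) (by norm_num [abs_of_pos])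
  rw [← smul_mul_assoc, ← hnu, hxq, abs_of_pos (by norm_num)] at h1
  exact h1.trans (mul_le_of_le_one_right' (H x (hxm.trans_le hF)))

/-- A multiplier of norm at most one has modular at most `1 / 2` in `ℓ_{rₙ}` after halving. -/
theorem tsum_nakanoTerm_half_le (hp : ∀ n, 1 ≤ p n) (hq : ∀ n, 1 ≤ q n) {mu : ℕ → ℝ}
    (H : ∀ x, nakanoModular p x ≤ 1 → nakanoModular q (mu * x) ≤ 1) :
    ∑' n, nakanoTerm p q ((1 / 2 : ℝ) • mu) n ≤ ENNReal.ofReal (1 / 2) := by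
  classical
  refine ENNReal.summable.tsum_le_of_sum_le fun F => ?_
  -- One new term is at most `1 / 2`, so the enlarged sum is at most 1 and improves back to `1 / 2`.
  induction F using Finset.induction_on with
  | empty => simp
  | insert n F hn ih =>
    refine sum_nakanoTerm_half_le hp hq H ?_
    rw [Finset.sum_insert hn]
    have h1 : nakanoTerm p q ((1 / 2 : ℝ) • mu) n ≤ ENNReal.ofReal (1 / 2) := by
      by_cases h : q n < p n
      · rw [nakanoTerm_of_lt h]
        refine ENNReal.ofReal_le_ofReal ?_
        have h2 : |((1 / 2 : ℝ) • mu) n| ≤ 1 / 2 := by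
          rw [Pi.smul_apply, smul_eq_mul, abs_mul, abs_of_pos (by norm_num : (0 : ℝ) < 1 / 2)]
          linarith [abs_le_one_of_modular_mul_le hp hq H n]
        calc |((1 / 2 : ℝ) • mu) n| ^ nakanoExponent p q n
            ≤ |((1 / 2 : ℝ) • mu) n| ^ (1 : ℝ) :=
              Real.rpow_le_rpow_of_exponent_ge' (abs_nonneg _) (by linarith) zero_le_one
                (one_le_nakanoExponent hp hq h)
          _ ≤ 1 / 2 := by rwa [Real.rpow_one]
      · rw [nakanoTerm_of_not_lt h]; exact zero_le
    refine (add_le_add h1 ih).trans ?_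
    rw [← ENNReal.ofReal_add (by norm_num) (by norm_num)]
    norm_num

/-- Young's inequality for the modulars. -/
theorem nakanoModular_mul_le (hp : ∀ n, 1 ≤ p n) (hq : ∀ n, 1 ≤ q n) (hqp : ∀ n, q n ≤ p n)
    {mu : ℕ → ℝ} (hmu : ∀ n, q n = p n → |mu n| ≤ 1) (x : ℕ → ℝ) :
    nakanoModular q (mu * x) ≤ (∑' n, nakanoTerm p q mu n) + nakanoModular p x := by
  unfold nakanoModular
  rw [← ENNReal.tsum_add]
  refine ENNReal.tsum_le_tsum fun n => ?_
  rw [Pi.mul_apply, abs_mul]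
  rcases (hqp n).lt_or_eq with h | h
  · rw [nakanoTerm_of_lt h, ← ENNReal.ofReal_add (by positivity) (by positivity)]
    exact ENNReal.ofReal_le_ofReal
      (mul_rpow_le_rpow_nakanoExponent_add hp hq h (abs_nonneg _) (abs_nonneg _))
  · rw [nakanoTerm_of_not_lt h.not_lt, zero_add, h]
    refine ENNReal.ofReal_le_ofReal (Real.rpow_le_rpow (by positivity) ?_ (by linarith [hp n]))
    exact mul_le_of_le_one_left (abs_nonneg _) (hmu n h)

end Multiplier

/-! ### Vanishing tails, summability and truncated sums. -/

section Criterion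

variable {p q lam : ℕ → ℝ} {hp : ∀ n, 1 ≤ p n} {hq : ∀ n, 1 ≤ q n}

/-- The tails of `lam` tend to zero in the space of multipliers from `ℓ_{pₙ}` to `ℓ_{qₙ}`. -/
def NakanoTailVanishing (p q lam : ℕ → ℝ) : Prop :=
  ∀ L : ℝ, 0 < L → ∃ N : ℕ, ∀ x, nakanoModular p x ≤ 1 →
    nakanoModular q ((L • (Set.Ici N).indicator lam) * x) ≤ 1

theorem smul_indicator_mul_eq (L : ℝ) (s : Set ℕ) (lam x : ℕ → ℝ) :
    (L • s.indicator lam) * x = L • s.indicator (lam * x) := by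
  ext n
  by_cases hn : n ∈ s <;> simp [hn, mul_assoc]

theorem nakanoNorm_le_one {x : ℕ → ℝ} (h : nakanoModular p x ≤ 1) : nakanoNorm p x ≤ 1 :=
  nakanoNorm_le one_pos (by simpa using h)

theorem IsCompactOperator.nakanoTailVanishing (hbdd : BddAbove (Set.range q))
    {hlam : IsNakanoMultiplier p q lam} (h : IsCompactOperator (nakanoMul hp hq hlam)) :
    NakanoTailVanishing p q lam := by
  intro L hL
  -- Halving makes the norm strictly less than `L⁻¹`, as the passage to the modular requires.
  obtain ⟨N, hN⟩ := h.exists_nakano_tail_le hbdd (ε := L⁻¹ / 2) (by positivity)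
  refine ⟨N, fun x hx => ?_⟩
  have hxm : MemNakano p x := memNakano_of_modular_lt_top (hx.trans_lt ENNReal.one_lt_top)
  have h1 : nakanoNorm q ((Set.Ici N).indicator (lam * x)) ≤ L⁻¹ / 2 :=
    hN (⟨x, hxm⟩ : nakanoSubmodule p hp) (nakanoNorm_le_one hx)
  have hm : MemNakano q ((Set.Ici N).indicator (lam * x)) :=
    (hlam x hxm).mono hq fun n => by
      by_cases hn : n ∈ Set.Ici N
      · rw [Set.indicator_of_mem hn]
      · rw [Set.indicator_of_notMem hn, abs_zero]; exact abs_nonneg _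
  have h2 := nakanoModular_inv_smul_le_one hq hm
    (h1.trans_lt (half_lt_self (inv_pos.2 hL)))
  rwa [inv_inv, ← smul_indicator_mul_eq] at h2

theorem NakanoTailVanishing.isCompactOperator (h : NakanoTailVanishing p q lam)
    (hlam : IsNakanoMultiplier p q lam) : IsCompactOperator (nakanoMul hp hq hlam) := by
  refine isCompactOperator_nakanoMul_of_tail hlam fun ε hε => ?_
  obtain ⟨N, hN⟩ := h ε⁻¹ (inv_pos.2 hε)
  refine ⟨N, fun x => ?_⟩
  rw [← div_le_iff₀' hε]
  refine le_of_forall_gt_imp_ge_of_dense fun ρ hρ => ?_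
  have hρ0 : 0 < ρ := (norm_nonneg x).trans_lt hρ
  rw [div_le_iff₀' hε]
  refine nakanoNorm_le (mul_pos hε hρ0) ?_
  have h1 := hN _ (nakanoModular_inv_smul_le_one hp x.2 hρ)
  rwa [mul_smul_comm, smul_indicator_mul_eq, smul_smul, ← mul_inv, mul_comm ρ] at h1

theorem NakanoTailVanishing.tendsto_zero (hp : ∀ n, 1 ≤ p n) (hq : ∀ n, 1 ≤ q n)
    (h : NakanoTailVanishing p q lam) : Tendsto lam atTop (𝓝 0) := by
  rw [Metric.tendsto_atTop]
  intro ε hε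
  obtain ⟨N, hN⟩ := h (ε / 2)⁻¹ (by positivity)
  refine ⟨N, fun n hn => ?_⟩
  have h1 := abs_le_one_of_modular_mul_le hp hq hN n
  rw [Pi.smul_apply, Set.indicator_of_mem (Set.mem_Ici.2 hn), smul_eq_mul, abs_mul,
    abs_of_pos (by positivity : (0 : ℝ) < (ε / 2)⁻¹), inv_mul_le_iff₀ (by positivity),
    mul_one] at h1
  rw [dist_zero_right, Real.norm_eq_abs]
  linarith

theorem nakanoTerm_congr {mu nu : ℕ → ℝ} {n : ℕ} (h : mu n = nu n) :
    nakanoTerm p q mu n = nakanoTerm p q nu n := by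
  by_cases hn : q n < p n
  · rw [nakanoTerm_of_lt hn, nakanoTerm_of_lt hn, h]
  · rw [nakanoTerm_of_not_lt hn, nakanoTerm_of_not_lt hn]

theorem NakanoTailVanishing.tsum_lt_top (hp : ∀ n, 1 ≤ p n) (hq : ∀ n, 1 ≤ q n)
    (h : NakanoTailVanishing p q lam) {l : ℝ} (hl : 0 < l) :
    ∑' n, nakanoTerm p q (l • lam) n < ∞ := by
  -- The 2 offsets the halving in `tsum_nakanoTerm_half_le`.
  obtain ⟨N, hN⟩ := h (2 * l) (by positivity)
  have h1 := (tsum_nakanoTerm_half_le hp hq hN).trans_lt ENNReal.ofReal_lt_top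
  rw [← ENNReal.summable.sum_add_tsum_nat_add' (k := N)]
  refine ENNReal.add_lt_top.2
    ⟨ENNReal.sum_lt_top.2 fun n _ => nakanoTerm_lt_top _ _, lt_of_le_of_lt ?_ h1⟩
  refine le_trans (le_of_eq (tsum_congr fun n => nakanoTerm_congr ?_))
    (ENNReal.tsum_comp_le_tsum_of_injective (add_left_injective N) _)
  simp only [Pi.smul_apply, smul_eq_mul]
  rw [Set.indicator_of_mem (by simp)]
  ring

theorem nakanoTailVanishing_of_tsum_lt_top (hp : ∀ n, 1 ≤ p n) (hq : ∀ n, 1 ≤ q n)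
    (hqp : ∀ n, q n ≤ p n) (h : ∀ l : ℝ, 1 < l → ∑' n, nakanoTerm p q (l • lam) n < ∞)
    (h0 : Tendsto lam (atTop ⊓ 𝓟 {n : ℕ | q n = p n}) (𝓝 0)) :
    NakanoTailVanishing p q lam := by
  intro L hL
  -- The factor 2 absorbs the bound `1 + 1` from Young's inequality, by convexity; the maximum
  -- ensures `l > 1`.
  set l := 2 * max L 1 with hl
  have hlL : 2 * L ≤ l := by rw [hl]; gcongr; exact le_max_left _ _
  have hl1 : 1 < l := by linarith [le_max_right L 1]
  have e1 := (tendsto_tsum_indicator_Ici (h l hl1).ne).eventually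
    (eventually_le_nhds (show (0 : ℝ≥0∞) < 1 by simp))
  have e2 : ∀ᶠ n in atTop, q n = p n → |lam n| ≤ l⁻¹ := by
    have := h0.abs.eventually (eventually_le_nhds (a := |0|) (b := l⁻¹)
      (by rw [abs_zero]; positivity))
    exact eventually_inf_principal.1 this
  obtain ⟨N, hN1, hN2⟩ := (e1.and (eventually_forall_ge_atTop.2 e2)).exists
  refine ⟨N, fun x hx => ?_⟩
  set mu : ℕ → ℝ := l • (Set.Ici N).indicator lam with hmu
  have hmu1 (n : ℕ) (hn : q n = p n) : |mu n| ≤ 1 := by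
    rw [hmu, Pi.smul_apply, smul_eq_mul, abs_mul, abs_of_pos (by linarith),
      ← le_inv_mul_iff₀ (by linarith), mul_one]
    by_cases hnN : n ∈ Set.Ici N
    · rw [Set.indicator_of_mem hnN]; exact hN2 n hnN hn
    · rw [Set.indicator_of_notMem hnN, abs_zero]; positivity
  have hterm (n : ℕ) : nakanoTerm p q mu n =
      (Set.Ici N).indicator (nakanoTerm p q (l • lam)) n := by
    by_cases hnN : n ∈ Set.Ici N
    · rw [Set.indicator_of_mem hnN]
      exact nakanoTerm_congr (by simp [hmu, Set.indicator_of_mem hnN])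
    · rw [Set.indicator_of_notMem hnN]
      by_cases hlt : q n < p n
      · have : 1 ≤ nakanoExponent p q n := one_le_nakanoExponent hp hq hlt
        rw [nakanoTerm_of_lt hlt, hmu, Pi.smul_apply, Set.indicator_of_notMem hnN, smul_zero,
          abs_zero, Real.zero_rpow (by linarith), ENNReal.ofReal_zero]
      · exact nakanoTerm_of_not_lt hlt
  have h2 : nakanoModular q (mu * x) ≤ 2 := by
    refine (nakanoModular_mul_le hp hq hqp hmu1 x).trans ?_
    rw [tsum_congr hterm, ← one_add_one_eq_two]
    exact add_le_add hN1 hx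
  have h3 := nakanoModular_smul_le hq (mu * x) (c := 1 / 2) (by norm_num [abs_of_pos])
  refine (nakanoModular_mono hq fun n => ?_).trans (h3.trans ?_)
  · simp only [hmu, Pi.smul_apply, Pi.mul_apply, smul_eq_mul, abs_mul]
    rw [← mul_assoc, ← mul_assoc]
    gcongr
    rw [abs_of_pos hL, abs_of_pos (by linarith : 0 < l), abs_of_pos (by norm_num)]
    linarith
  · calc _ ≤ ENNReal.ofReal |1 / 2| * 2 := by gcongr
      _ = 1 := by
        rw [abs_of_pos (by norm_num), ← ENNReal.ofReal_ofNat 2,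
          ← ENNReal.ofReal_mul (by norm_num)]
        norm_num

/-- A multiplier, suitably scaled, has finite modular in `ℓ_{rₙ}`. -/
theorem IsNakanoMultiplier.exists_tsum_lt_top (hp : ∀ n, 1 ≤ p n) (hq : ∀ n, 1 ≤ q n)
    (hlam : IsNakanoMultiplier p q lam) :
    ∃ c : ℝ, 0 < c ∧ ∑' n, nakanoTerm p q (c • lam) n < ∞ := by
  let T : NakanoSpace p hp →L[ℝ] NakanoSpace q hq := ⟨nakanoMul hp hq hlam,
    continuous_nakanoMul hlam⟩
  -- Adding 1 avoids dividing by zero and gives the strict norm inequality used below.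
  have hC : 0 < ‖T‖ + 1 := by positivity
  have H : ∀ x, nakanoModular p x ≤ 1 →
      nakanoModular q (((‖T‖ + 1)⁻¹ • lam) * x) ≤ 1 := by
    intro x hx
    have hxm : MemNakano p x := memNakano_of_modular_lt_top (hx.trans_lt ENNReal.one_lt_top)
    let y : NakanoSpace p hp := ⟨x, hxm⟩
    have hy : ‖y‖ ≤ 1 := nakanoNorm_le_one hx
    have h1 : nakanoNorm q (lam * x) ≤ ‖T‖ := T.unit_le_opNorm y hy
    rw [smul_mul_assoc]
    exact nakanoModular_inv_smul_le_one hq (hlam x hxm) (by linarith)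
  refine ⟨1 / 2 * (‖T‖ + 1)⁻¹, by positivity, ?_⟩
  have h1 := tsum_nakanoTerm_half_le hp hq H
  rw [smul_smul] at h1
  exact h1.trans_lt ENNReal.ofReal_lt_top

theorem nakanoTerm_smul_of_lt {l : ℝ} (hl : 0 < l) {n : ℕ} (hn : q n < p n) :
    nakanoTerm p q (l • lam) n = ENNReal.ofReal ((|lam n| * l) ^ nakanoExponent p q n) := by
  rw [nakanoTerm_of_lt hn, Pi.smul_apply, smul_eq_mul, abs_mul, abs_of_pos hl, mul_comm]

/-- The indices of the `k`-th truncated sum. -/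
def nakanoTruncation (p q lam : ℕ → ℝ) (l : ℝ) (k : ℕ) : Set ℕ :=
  {n | lam n ≠ 0 ∧ q n < p n ∧ Real.log k / Real.log l < nakanoExponent p q n}

theorem tsum_truncation_eq {l : ℝ} (hl : 1 < l) (k : ℕ) :
    ∑' n : nakanoTruncation p q lam l k,
        ENNReal.ofReal ((|lam n| * l) ^ nakanoExponent p q n) =
      ∑' n, (nakanoTruncation p q lam l k).indicator (nakanoTerm p q (l • lam)) n := by
  rw [← tsum_subtype]
  exact tsum_congr fun n => (nakanoTerm_smul_of_lt (by linarith) n.2.2.1).symm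

/-- Each `r_n` is finite while `log k / log l → ∞`, so the index sets eventually avoid any initial
segment and the sums are dominated by tails of a convergent series. -/
theorem tendsto_tsum_truncation {l : ℝ} (hl : 1 < l)
    (h : ∑' n, nakanoTerm p q (l • lam) n < ∞) :
    Tendsto (fun k : ℕ => ∑' n : nakanoTruncation p q lam l k,
      ENNReal.ofReal ((|lam n| * l) ^ nakanoExponent p q n)) atTop (𝓝 0) := by
  simp only [tsum_truncation_eq hl]
  refine ENNReal.tendsto_nhds_zero.2 fun ε hε => ?_
  obtain ⟨N, hN⟩ := ((tendsto_tsum_indicator_Ici h.ne).eventually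
    (eventually_le_nhds hε)).exists
  have hlog : Tendsto (fun k : ℕ => Real.log k / Real.log l) atTop atTop :=
    (Real.tendsto_log_atTop.comp tendsto_natCast_atTop_atTop).atTop_div_const (Real.log_pos hl)
  have hall : ∀ᶠ k : ℕ in atTop, ∀ n ∈ Finset.range N,
      nakanoExponent p q n ≤ Real.log k / Real.log l :=
    (Finset.eventually_all _).2 fun n _ => hlog.eventually_ge_atTop _
  filter_upwards [hall] with k hk
  refine (ENNReal.tsum_le_tsum fun n => ?_).trans hN
  refine Set.indicator_le_indicator_of_subset (fun m hm => ?_) (fun _ => zero_le) n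
  by_contra hmN
  exact (hk m (by simpa using hmN)).not_gt hm.2.2

/-- A single `k` with finite truncated sum suffices: it handles `r_n > R`, and for `r_n ≤ R` the
term at `l` is at most `B ^ R` times the summable term at `c`. -/
theorem tsum_lt_top_of_tendsto_truncation (hp : ∀ n, 1 ≤ p n) (hq : ∀ n, 1 ≤ q n)
    (hlam : IsNakanoMultiplier p q lam) {l : ℝ} (hl : 1 < l)
    (h : Tendsto (fun k : ℕ => ∑' n : nakanoTruncation p q lam l k,
      ENNReal.ofReal ((|lam n| * l) ^ nakanoExponent p q n)) atTop (𝓝 0)) :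
    ∑' n, nakanoTerm p q (l • lam) n < ∞ := by
  obtain ⟨c, hc, hsum⟩ := hlam.exists_tsum_lt_top hp hq
  simp only [tsum_truncation_eq hl] at h
  obtain ⟨k, hk⟩ := (h.eventually (eventually_lt_nhds ENNReal.zero_lt_top)).exists
  have hl0 : 0 < l := by linarith
  set R := Real.log k / Real.log l with hR
  -- The maximum with 1 makes `B ^ r` increasing in `r`.
  set B := max 1 (l / c) with hB
  have hB1 : 1 ≤ B := le_max_left _ _
  refine (ENNReal.tsum_le_tsum fun n => ?_ : _ ≤ ∑' n,
    ((nakanoTruncation p q lam l k).indicator (nakanoTerm p q (l • lam)) n +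
      ENNReal.ofReal (B ^ R) * nakanoTerm p q (c • lam) n)).trans_lt ?_
  · by_cases hn : n ∈ nakanoTruncation p q lam l k
    · rw [Set.indicator_of_mem hn]; exact le_self_add
    rw [Set.indicator_of_notMem hn, zero_add]
    by_cases hlt : q n < p n
    · have hr1 := one_le_nakanoExponent hp hq hlt
      rw [nakanoTerm_smul_of_lt hl0 hlt, nakanoTerm_smul_of_lt hc hlt,
        ← ENNReal.ofReal_mul (by positivity)]
      refine ENNReal.ofReal_le_ofReal ?_
      by_cases h0 : lam n = 0
      · rw [h0, abs_zero, zero_mul, zero_mul, Real.zero_rpow (by linarith), mul_zero]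
      have hrR : nakanoExponent p q n ≤ R := not_lt.1 fun hlt' => hn ⟨h0, hlt, hlt'⟩
      calc (|lam n| * l) ^ nakanoExponent p q n
          = (l / c * (|lam n| * c)) ^ nakanoExponent p q n := by
            congr 1; field_simp
        _ = (l / c) ^ nakanoExponent p q n * (|lam n| * c) ^ nakanoExponent p q n :=
            Real.mul_rpow (by positivity) (by positivity)
        _ ≤ B ^ R * (|lam n| * c) ^ nakanoExponent p q n := by
            gcongr
            exact (Real.rpow_le_rpow (by positivity) (le_max_right _ _) (by linarith)).trans
              (Real.rpow_le_rpow_of_exponent_le hB1 hrR)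
    · rw [nakanoTerm_of_not_lt hlt]; exact zero_le
  · rw [ENNReal.tsum_add, ENNReal.tsum_mul_left]
    exact ENNReal.add_lt_top.2 ⟨hk, ENNReal.mul_lt_top ENNReal.ofReal_lt_top hsum⟩

end Criterion

theorem mainTheorem10 (p q : ℕ → ℝ) (hp : ∀ n, 1 ≤ p n) (hq : ∀ n, 1 ≤ q n)
    (hqp : ∀ n, q n ≤ p n)
    (hpq : (1 < ⨅ n, p n ∧ BddAbove (Set.range p)) ∨ BddAbove (Set.range q))
    (lam : ℕ → ℝ) (hlam : IsNakanoMultiplier p q lam) :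
    IsCompactOperator (nakanoMul hp hq hlam) ↔
      (∀ l : ℝ, 1 < l →
        Tendsto (fun k : ℕ =>
          ∑' n : {n : ℕ | lam n ≠ 0 ∧ q n < p n ∧
              Real.log k / Real.log l < nakanoExponent p q n},
            ENNReal.ofReal ((|lam n| * l) ^ nakanoExponent p q n))
          atTop (𝓝 0)) ∧
      Tendsto lam (atTop ⊓ 𝓟 {n : ℕ | q n = p n}) (𝓝 0) := by
  -- Either alternative bounds `q`, because `q ≤ p`.
  have hbdd : BddAbove (Set.range q) := by
    rcases hpq with ⟨-, P, hP⟩ | h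
    · exact ⟨P, by rintro _ ⟨n, rfl⟩; exact (hqp n).trans (hP ⟨n, rfl⟩)⟩
    · exact h
  constructor
  · intro h
    have htail := h.nakanoTailVanishing hbdd
    exact ⟨fun l hl => tendsto_tsum_truncation hl (htail.tsum_lt_top hp hq (by linarith)),
      (htail.tendsto_zero hp hq).mono_left inf_le_left⟩
  · rintro ⟨h1, h2⟩
    exact (nakanoTailVanishing_of_tsum_lt_top hp hq hqp
      (fun l hl => tsum_lt_top_of_tendsto_truncation hp hq hlam hl (h1 l hl))
      h2).isCompactOperator hlam
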